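/- For $n\ge 1$ let $D_n$ be the set of derangements (permutations without fixed points) of $\{1,\dots,n\}$, let $\mathrm{maj}(\pi)=\sum_{1\le i<n,\ \pi(i)>\pi(i+1)} i$ be the major index of a permutation $\pi$, and let $$d_n(q)=\sum_{\pi\in D_n}q^{\mathrm{maj}(\pi)}$$ be the $q$-derangement number. Let $\beta_n$ be the degree of $d_n(q)$ and let $A_n(k)$ be the coefficient of $q^k$ in $d_n(q)$. Call a finite sequence $a_1,\dots,a_m$ of positive numbers log-concave if $\frac{a_1}{a_2}<\frac{a_2}{a_3}<\cdots<\frac{a_{m-1}}{a_m}$. **Corollary.** Let $n\ge 6$ and $r=\frac{n(n-1)}{2}-1$. Then $$\frac{A_n(1)}{A_n(2)}<\frac{A_n(2)}{A_n(3)}<\cdots<\frac{A_n(r-2)}{A_n(r-1)}<\frac{A_n(r-1)}{A_n(r)}.$$ Consequently $d_n(q)$ is log-concave for odd $n$, and log-concave except for the last term for even $n$. Precisely, $A_n(0)=0$, and: * if $n$ is odd, then $\beta_n=r$ and the sequence $A_n(1),\dots,A_n(\beta_n)$ is positive and log-concave; * if $n$ is even, then $\beta_n=r+1$, the sequence $A_n(1),\dots,A_n(\beta_n-1)$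 is positive and log-concave, and the last coefficient $A_n(\beta_n)$ is positive but violates log-concavity: $\dfrac{A_n(\beta_n)}{A_n(\beta_n-1)}>\dfrac{A_n(\beta_n-1)}{A_n(\beta_n-2)}$. -/

import Mathlib

/-- The major index of a permutation `π` of `{1, …, n}` (modelled on `Fin n = {0, …, n - 1}`):
the sum of the descent positions, counted from `1`. The descent at the `0`-based position `i`,
that is `π i > π (i + 1)`, contributes `i + 1`. -/
def majorIndex {n : ℕ} (π : Equiv.Perm (Fin n)) : ℕ :=
  ∑ i : Fin n, if ∃ h : (i : ℕ) + 1 < n, π ⟨(i : ℕ) + 1, h⟩ < π i then (i : ℕ) + 1 else 0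

open scoped Classical in
/-- The `q`-derangement number `d_n(q) = ∑ q ^ maj(π)`, the sum being over all
derangements (fixed-point free permutations) `π` of an `n`-element set. -/
noncomputable def qDerangement (n : ℕ) : Polynomial ℤ :=
  ∑ π ∈ (Finset.univ : Finset (Equiv.Perm (Fin n))).filter (fun π => π ∈ derangements (Fin n)),
    Polynomial.X ^ majorIndex π

/-- `A_n(k)`, the coefficient of `q ^ k` in `d_n(q)`, as a rational number. -/
noncomputable def qDerangementCoeff (n k : ℕ) : ℚ :=
  ((qDerangement n).coeff k : ℚ)

/-- The sequence `a 1, a 2, …, a m` is positive and (strictly) log-concave: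
`a 1 / a 2 < a 2 / a 3 < ⋯ < a (m - 1) / a m`. -/
def IsStrictLogConcaveSeq (a : ℕ → ℚ) (m : ℕ) : Prop :=
  (∀ k, 1 ≤ k → k ≤ m → 0 < a k) ∧
    ∀ k, 1 ≤ k → k + 2 ≤ m → a k / a (k + 1) < a (k + 1) / a (k + 2)

/-! Write `[m] = 1 + q + ⋯ + q^(m-1)`. Everything rests on the recurrence `d_{n+1} = [n+1] d_n +
(-1)^(n+1) q^(n(n+1)/2)` (`qDerangement_succ`): apart from a correction `±1` at one index, the
coefficients of `d_{n+1}` are sums of `n + 1` consecutive coefficients of `d_n`.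

The recurrence comes from sorting permutations by their sets of fixed points. Compared with their
neighbours, fixed points behave like copies of a single letter lying below every excedance and above
every other letter. Over all ways to shuffle such copies into a word, the major index is distributed
as a Gaussian binomial, shifted by the major index of the word (`sum_pow_wordMaj_shuffle`). Hence
the generating function of all permutations is `∑ qBinom n k * d_k`; inserting a maximal letter, by
the same shuffle lemma, multiplies it by `[n+1]`. The `q`-binomial theorem then gives the
recurrence.

Window sums preserve strict log-concavity, because the relevant difference is a sum of cross
differences `a i * a j - a (i-1) * a (j+1)` with `i ≤ j` (`windowSum_sq_sub`). For even `n` the last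
coefficient `1` makes exactly one of these negative, at `i = j = m`, and its neighbours outweigh it.
To guarantee this, the induction from `n = 5` also carries the exact values of the top coefficients
and two inequalities on the next two (`OddProfile`, `EvenProfile`). -/

open Polynomial in
/-- The Gaussian binomial coefficient, as a polynomial in `q = X`. -/
noncomputable def qBinom : ℕ → ℕ → Polynomial ℤ
  | _, 0 => 1
  | 0, _ + 1 => 0
  | n + 1, k + 1 => qBinom n k + X ^ (k + 1) * qBinom n (k + 1)

/-! ### Gaussian binomial coefficients. -/

section QBinom
open Polynomial

@[simp] lemma qBinom_zero_right (n : ℕ) : qBinom n 0 = 1 := by cases n <;> simp [qBinom]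

@[simp] lemma qBinom_zero_succ (k : ℕ) : qBinom 0 (k + 1) = 0 := by simp [qBinom]

lemma qBinom_succ_succ (n k : ℕ) :
    qBinom (n + 1) (k + 1) = qBinom n k + X ^ (k + 1) * qBinom n (k + 1) := by
  simp [qBinom]

lemma qBinom_eq_zero_of_lt : ∀ {n k : ℕ}, n < k → qBinom n k = 0
  | _, 0, h => absurd h (by omega)
  | 0, k + 1, _ => by simp
  | n + 1, k + 1, h => by
    rw [qBinom_succ_succ, qBinom_eq_zero_of_lt (by omega : n < k),
      qBinom_eq_zero_of_lt (by omega : n < k + 1)]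
    simp

@[simp] lemma qBinom_self : ∀ n : ℕ, qBinom n n = 1
  | 0 => by simp
  | n + 1 => by
    rw [qBinom_succ_succ, qBinom_self n, qBinom_eq_zero_of_lt (Nat.lt_succ_self n)]
    simp

/-- The second Pascal rule. Having both rules is what makes the shuffle count work: which one
applies depends on whether the last letter of the word exceeds the inserted letter. -/
lemma qBinom_succ_succ' : ∀ {n k : ℕ}, k ≤ n →
    qBinom (n + 1) (k + 1) = X ^ (n - k) * qBinom n k + qBinom n (k + 1)
  | 0, 0, _ => by simp
  | n + 1, 0, _ => by
    have ih := qBinom_succ_succ' (Nat.zero_le n)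
    have h₁ := qBinom_succ_succ (n + 1) 0
    have h₂ := qBinom_succ_succ n 0
    simp only [qBinom_zero_right, Nat.sub_zero, Nat.zero_add, pow_one, mul_one] at *
    rw [h₁, pow_succ]
    linear_combination X * ih - h₂
  | n + 1, k + 1, h => by
    have hk : k ≤ n := by omega
    rcases hk.eq_or_lt with rfl | hlt
    · simp [qBinom_eq_zero_of_lt]
    · obtain ⟨m, rfl⟩ := Nat.exists_eq_add_of_lt hlt
      have ih₁ := qBinom_succ_succ' hk
      have ih₂ := qBinom_succ_succ' (show k + 1 ≤ k + m + 1 by omega)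
      have h₁ := qBinom_succ_succ (k + m + 1 + 1) (k + 1)
      have h₂ := qBinom_succ_succ (k + m + 1) (k + 1)
      have h₃ := qBinom_succ_succ (k + m + 1) k
      rw [show k + m + 1 - k = m + 1 by omega] at ih₁
      rw [show k + m + 1 - (k + 1) = m by omega] at ih₂
      rw [show k + m + 1 + 1 - (k + 1) = m + 1 by omega]
      rw [h₁]
      linear_combination ih₁ + X ^ (k + 1 + 1) * ih₂ - h₂ - X ^ (m + 1) * h₃

lemma pow_sub_one_mul_qBinom_succ_succ {n k : ℕ} (h : k ≤ n) :
    (X ^ (k + 1) - 1) * qBinom (n + 1) (k + 1) = (X ^ (n + 1) - 1) * qBinom n k := by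
  have h₁ := qBinom_succ_succ n k
  have h₂ := qBinom_succ_succ' h
  have h₃ : (X : Polynomial ℤ) ^ (n + 1) = X ^ (k + 1) * X ^ (n - k) := by
    rw [← pow_add]; congr 1; omega
  rw [h₃]
  linear_combination X ^ (k + 1) * h₂ - h₁

/-- The absorption identity: eliminating `qBinom n (k + 1)` between the two Pascal rules gives it
with `X ^ m - 1` for `[m]`, and `X - 1` cancels. -/
lemma geom_sum_mul_qBinom_succ_succ {n k : ℕ} (h : k ≤ n) :
    (∑ i ∈ Finset.range (k + 1), X ^ i) * qBinom (n + 1) (k + 1) =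
      (∑ i ∈ Finset.range (n + 1), X ^ i) * qBinom n k := by
  have hX : (X - 1 : Polynomial ℤ) ≠ 0 := by
    simpa using X_sub_C_ne_zero (1 : ℤ)
  refine mul_right_cancel₀ hX ?_
  have e₁ := geom_sum_mul (X : Polynomial ℤ) (k + 1)
  have e₂ := geom_sum_mul (X : Polynomial ℤ) (n + 1)
  linear_combination pow_sub_one_mul_qBinom_succ_succ h + qBinom (n + 1) (k + 1) * e₁
    - qBinom n k * e₂

lemma qBinom_succ_self (n : ℕ) : qBinom (n + 1) n = ∑ i ∈ Finset.range (n + 1), X ^ i := by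
  induction n with
  | zero => simp
  | succ n ih =>
    rw [qBinom_succ_succ, ih, qBinom_self, mul_one, ← Finset.sum_range_succ]

/-- The `q`-binomial theorem at the value where the product vanishes. -/
lemma sum_neg_one_pow_mul_qBinom (n : ℕ) :
    ∑ k ∈ Finset.range (n + 1), (-1) ^ (k + 1) * X ^ ((k + 1).choose 2) * qBinom (n + 1) (k + 1)
      = -1 := by
  -- Partial sums have a closed form by the first Pascal rule; at `m = n + 1` its Gaussian binomial
  -- vanishes.
  have key : ∀ m : ℕ,
      ∑ k ∈ Finset.range m, (-1) ^ (k + 1) * X ^ ((k + 1).choose 2) * qBinom (n + 1) (k + 1)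
        = (-1) ^ m * X ^ ((m + 1).choose 2) * qBinom n m - 1 := by
    intro m
    induction m with
    | zero => simp
    | succ m ih =>
      rw [Finset.sum_range_succ, ih, qBinom_succ_succ,
        show (m + 1 + 1).choose 2 = (m + 1) + (m + 1).choose 2 by
          rw [Nat.choose_succ_succ' (m + 1) 1, Nat.choose_one_right]]
      ring
  rw [key, qBinom_eq_zero_of_lt (Nat.lt_succ_self n)]
  simp

end QBinom

/-- Let `w` be a word and let a word be obtained from it by inserting copies of a letter `z`, the
letters of `w` ending up at the positions in `A`. Here `T r` says that the `r`-th letter of `w`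
exceeds `z`, and `D r` that `w` has a descent between its letters `r` and `r + 1`.
`ShuffleDescent D T A i` says that the new word has a descent between the positions `i`
and `i + 1`. -/
def ShuffleDescent (D T : ℕ → Prop) (A : Finset ℕ) (i : ℕ) : Prop :=
  (i ∈ A ∧ i + 1 ∈ A ∧ D (Nat.count (· ∈ A) i)) ∨
  (i ∈ A ∧ i + 1 ∉ A ∧ T (Nat.count (· ∈ A) i)) ∨
  (i ∉ A ∧ i + 1 ∈ A ∧ ¬ T (Nat.count (· ∈ A) i))

open scoped Classical in
/-- The major index of a word of length `N + 1` with descent predicate `D`. -/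
noncomputable def wordMaj (D : ℕ → Prop) (N : ℕ) : ℕ :=
  ∑ i ∈ Finset.range N, if D i then i + 1 else 0

/-! ### Major index of shuffles with copies of one letter. -/

section Shuffle
open Polynomial Finset
open scoped Classical

lemma wordMaj_succ (D : ℕ → Prop) (N : ℕ) :
    wordMaj D (N + 1) = wordMaj D N + if D N then N + 1 else 0 := by
  simp [wordMaj, sum_range_succ]

lemma wordMaj_congr {D D' : ℕ → Prop} {N : ℕ} (h : ∀ i < N, (D i ↔ D' i)) :
    wordMaj D N = wordMaj D' N := by
  refine sum_congr rfl fun i hi => ?_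
  simp only [h i (mem_range.1 hi)]

lemma count_mem_congr {A B : Finset ℕ} {N : ℕ} (h : ∀ i < N, (i ∈ A ↔ i ∈ B)) :
    Nat.count (· ∈ A) N = Nat.count (· ∈ B) N := by
  simp only [Nat.count_eq_card_filter_range]
  congr 1
  exact filter_congr fun i hi => h i (mem_range.1 hi)

lemma count_mem_eq_card {A : Finset ℕ} {N : ℕ} (h : A ⊆ range N) :
    Nat.count (· ∈ A) N = #A := by
  rw [Nat.count_eq_card_filter_range, filter_mem_eq_inter, inter_eq_right.2 h]

lemma shuffleDescent_congr {D T : ℕ → Prop} {A B : Finset ℕ} {i : ℕ}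
    (h : ∀ j ≤ i + 1, (j ∈ A ↔ j ∈ B)) : ShuffleDescent D T A i ↔ ShuffleDescent D T B i := by
  rw [ShuffleDescent, ShuffleDescent, h i (by omega), h (i + 1) le_rfl,
    count_mem_congr (fun j hj => h j (by omega))]

lemma wordMaj_shuffleDescent_insert (D T : ℕ → Prop) (A : Finset ℕ) (N : ℕ) :
    wordMaj (ShuffleDescent D T (insert (N + 1) A)) N = wordMaj (ShuffleDescent D T A) N := by
  refine wordMaj_congr fun i hi => shuffleDescent_congr fun j hj => ?_
  simp [show j ≠ N + 1 by omega]

lemma sum_powersetCard_range_succ {M : Type*} [AddCommMonoid M] (f : Finset ℕ → M) (N k : ℕ) :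
    ∑ A ∈ powersetCard (k + 1) (range (N + 1)), f A =
      ∑ A ∈ powersetCard (k + 1) (range N), f A +
        ∑ A ∈ powersetCard k (range N), f (insert N A) := by
  have hN : N ∉ range N := by simp
  rw [range_add_one, powersetCard_succ_insert hN, sum_union, sum_image]
  · intro A hA B hB h
    have hA' : N ∉ A := fun h => hN ((mem_powersetCard.1 hA).1 h)
    have hB' : N ∉ B := fun h => hN ((mem_powersetCard.1 hB).1 h)
    rw [← erase_insert hA', ← erase_insert hB', h]
  · rw [disjoint_left]
    intro A hA hA'
    obtain ⟨B, -, rfl⟩ := mem_image.1 hA'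
    exact hN ((mem_powersetCard.1 hA).1 (mem_insert_self _ _))

/-- The generating function of the insertions of a letter into a word of length `k`, the result
having length `N + 1` and ending with the inserted letter. -/
noncomputable def shuffleSumOut (D T : ℕ → Prop) (N k : ℕ) : Polynomial ℤ :=
  ∑ A ∈ powersetCard k (range N), X ^ wordMaj (ShuffleDescent D T A) N

/-- The generating function of the insertions of a letter into a word of length `k + 1`, the
result having length `N + 1` and ending with the last letter of the word. -/
noncomputable def shuffleSumIn (D T : ℕ → Prop) (N k : ℕ) : Polynomial ℤ :=
  ∑ A ∈ powersetCard k (range N), X ^ wordMaj (ShuffleDescent D T (insert N A)) N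

variable {D T : ℕ → Prop}

/-- Splits on the penultimate position: another inserted copy creates no descent, while the letter
`k` of the word creates one exactly when `T k`. -/
lemma shuffleSumOut_succ (N k : ℕ) : shuffleSumOut D T (N + 1) (k + 1) =
    shuffleSumOut D T N (k + 1) +
      shuffleSumIn D T N k * X ^ (if T k then N + 1 else 0) := by
  rw [shuffleSumOut, sum_powersetCard_range_succ, shuffleSumOut, shuffleSumIn, sum_mul]
  congr 1
  · refine sum_congr rfl fun A hA => ?_
    have hA := (mem_powersetCard.1 hA).1
    have h₁ : N ∉ A := fun h => by simpa using hA h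
    have h₂ : N + 1 ∉ A := fun h => by simpa using hA h
    rw [wordMaj_succ, if_neg (by simp [ShuffleDescent, h₁, h₂]), add_zero]
  · refine sum_congr rfl fun A hA => ?_
    obtain ⟨hA, hc⟩ := mem_powersetCard.1 hA
    have h₂ : N + 1 ∉ A := fun h => by simpa using hA h
    have h₃ : Nat.count (· ∈ insert N A) N = k := by
      rw [← hc, ← count_mem_eq_card hA]
      exact count_mem_congr fun i hi => by simp [hi.ne]
    have h₄ : ShuffleDescent D T (insert N A) N ↔ T k := by
      rw [ShuffleDescent, h₃]; simp [h₂]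
    simp only [wordMaj_succ, pow_add, h₄]

lemma shuffleSumIn_zero (N : ℕ) :
    shuffleSumIn D T N 0 = X ^ (if T 0 then 0 else N) := by
  cases N with
  | zero => simp [shuffleSumIn, wordMaj]
  | succ N =>
    have h : Nat.count (· ∈ ({N + 1} : Finset ℕ)) N = 0 := by
      rw [Nat.count_eq_card_filter_range, card_eq_zero, filter_eq_empty_iff]
      intro i hi
      simp only [mem_range, mem_singleton] at *
      omega
    simp only [shuffleSumIn, powersetCard_zero, sum_singleton, wordMaj_succ,
      wordMaj_shuffleDescent_insert]
    congr 1
    have h₁ : wordMaj (ShuffleDescent D T ∅) N = 0 := by simp [wordMaj, ShuffleDescent]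
    rw [h₁]
    have h₂ : ShuffleDescent D T {N + 1} N ↔ ¬ T 0 := by
      rw [ShuffleDescent, h]; simp
    by_cases hT : T 0 <;> simp [h₂, hT]

lemma shuffleSumIn_succ (N k : ℕ) : shuffleSumIn D T (N + 1) (k + 1) =
    shuffleSumOut D T N (k + 1) * X ^ (if T (k + 1) then 0 else N + 1) +
      shuffleSumIn D T N k * X ^ (if D k then N + 1 else 0) := by
  rw [shuffleSumIn, sum_powersetCard_range_succ, shuffleSumOut, shuffleSumIn, sum_mul, sum_mul]
  congr 1
  · refine sum_congr rfl fun A hA => ?_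
    obtain ⟨hA, hc⟩ := mem_powersetCard.1 hA
    have h₁ : N ∉ A := fun h => by simpa using hA h
    have h₃ : Nat.count (· ∈ insert (N + 1) A) N = k + 1 := by
      rw [← hc, ← count_mem_eq_card hA]
      exact count_mem_congr fun i hi => by simp [(show i ≠ N + 1 by omega)]
    have h₄ : ShuffleDescent D T (insert (N + 1) A) N ↔ ¬ T (k + 1) := by
      rw [ShuffleDescent, h₃]; simp [h₁]
    simp only [wordMaj_succ, wordMaj_shuffleDescent_insert, pow_add, h₄, ite_not]
  · refine sum_congr rfl fun A hA => ?_
    obtain ⟨hA, hc⟩ := mem_powersetCard.1 hA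
    have h₃ : Nat.count (· ∈ insert (N + 1) (insert N A)) N = k := by
      rw [← hc, ← count_mem_eq_card hA]
      exact count_mem_congr fun i hi => by simp [(show i ≠ N + 1 by omega), hi.ne]
    have h₄ : ShuffleDescent D T (insert (N + 1) (insert N A)) N ↔ D k := by
      rw [ShuffleDescent, h₃]; simp
    simp only [wordMaj_succ, wordMaj_shuffleDescent_insert, pow_add, h₄]

/-- The generating functions by major index of the insertions of a letter into a word, according
to whether the last letter of the word exceeds the inserted letter. -/
lemma shuffleSum_eq (hTD : ∀ r, T r → ¬ T (r + 1) → D r) (hDT : ∀ r, ¬ T r → T (r + 1) → ¬ D r)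
    (N k : ℕ) :
    shuffleSumIn D T N k = X ^ wordMaj D k * X ^ (if T k then 0 else N - k) * qBinom N k ∧
    shuffleSumOut D T N (k + 1) =
      X ^ wordMaj D k * X ^ (if T k then k + 1 else 0) * qBinom N (k + 1) := by
  induction N generalizing k with
  | zero =>
    constructor
    · cases k with
      | zero => simp [shuffleSumIn, wordMaj]
      | succ k => simp [shuffleSumIn, powersetCard_eq_empty.2 (show #(∅ : Finset ℕ) < k + 1 by simp)]
    · simp [shuffleSumOut, powersetCard_eq_empty.2 (show #(∅ : Finset ℕ) < k + 1 by simp)]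
  | succ N ih =>
    constructor
    · cases k with
      | zero => rw [shuffleSumIn_zero]; simp [wordMaj]
      | succ k =>
        obtain ⟨ih₁, ih₂⟩ := ih k
        have h₁ := qBinom_succ_succ N k
        have h₂ := qBinom_succ_succ' (n := N) (k := k)
        rw [shuffleSumIn_succ, ih₁, ih₂, wordMaj_succ, pow_add]
        have htd := hTD k
        have hdt := hDT k
        -- For `N < k` the truncated `N - k` is harmless, since all the Gaussian binomials vanish.
        by_cases h : k ≤ N
        · have h₂ := h₂ h
          rw [show N + 1 - (k + 1) = N - k by omega]
          have h₄ : (X : Polynomial ℤ) ^ (N + 1) = X ^ (N - k) * X ^ (k + 1) := by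
            rw [← pow_add]; congr 1; omega
          -- `hTD` and `hDT` exclude two of the eight cases; each of the others is a multiple of one
          -- of the two Pascal rules.
          by_cases hT : T k <;> by_cases hT' : T (k + 1) <;> by_cases hD : D k <;>
            simp only [hT, hT', hD, if_true, if_false, not_true, not_false_eq_true,
              forall_true_left, IsEmpty.forall_iff, pow_zero, mul_one] at htd hdt ⊢ <;>
            first
            | contradiction
            | linear_combination (-X ^ wordMaj D k) * h₁
            | linear_combination (-X ^ wordMaj D k) * h₂
            | (rw [h₄]; linear_combination (-X ^ wordMaj D k * X ^ (k + 1)) * h₂)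
            | (rw [h₄]; linear_combination (-X ^ wordMaj D k * X ^ (k + 1) * X ^ (N - k)) * h₂)
            | (rw [h₄]; linear_combination (-X ^ wordMaj D k * X ^ (k + 1) * X ^ (N - k)) * h₁)
            | (rw [h₄]; linear_combination (-X ^ wordMaj D k * X ^ (N - k)) * h₁)
        · simp [qBinom_eq_zero_of_lt (show N < k by omega),
            qBinom_eq_zero_of_lt (show N < k + 1 by omega),
            qBinom_eq_zero_of_lt (show N + 1 < k + 1 by omega)]
    · obtain ⟨ih₁, ih₂⟩ := ih k
      rw [shuffleSumOut_succ, ih₁, ih₂]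
      by_cases h : k ≤ N
      · have h₁ := qBinom_succ_succ N k
        have h₂ := qBinom_succ_succ' h
        have h₄ : (X : Polynomial ℤ) ^ (N + 1) = X ^ (N - k) * X ^ (k + 1) := by
          rw [← pow_add]; congr 1; omega
        by_cases hT : T k <;> simp only [hT, if_true, if_false, pow_zero, mul_one]
        · rw [h₄]; linear_combination (-X ^ wordMaj D k * X ^ (k + 1)) * h₂
        · linear_combination (-X ^ wordMaj D k) * h₂
      · simp [qBinom_eq_zero_of_lt (show N < k by omega),
            qBinom_eq_zero_of_lt (show N < k + 1 by omega),
            qBinom_eq_zero_of_lt (show N + 1 < k + 1 by omega)]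

/-- The major index is equidistributed, up to a shift, with a Gaussian binomial coefficient over
the insertions of copies of a letter into a word of length `k`. -/
lemma sum_pow_wordMaj_shuffle (hTD : ∀ r, T r → ¬ T (r + 1) → D r)
    (hDT : ∀ r, ¬ T r → T (r + 1) → ¬ D r) (N k : ℕ) :
    ∑ A ∈ powersetCard k (range (N + 1)), X ^ wordMaj (ShuffleDescent D T A) N =
      X ^ wordMaj D (k - 1) * qBinom (N + 1) k := by
  cases k with
  | zero => simp [wordMaj, ShuffleDescent]
  | succ k =>
    rw [sum_powersetCard_range_succ]
    obtain ⟨h₁, h₂⟩ := shuffleSum_eq hTD hDT N k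
    rw [shuffleSumIn] at h₁
    rw [shuffleSumOut] at h₂
    rw [h₁, h₂]
    by_cases h : k ≤ N
    · by_cases hT : T k <;> simp only [hT, if_true, if_false, pow_zero, mul_one, Nat.add_sub_cancel]
      · linear_combination (-X ^ wordMaj D k) * qBinom_succ_succ N k
      · linear_combination (-X ^ wordMaj D k) * qBinom_succ_succ' h
    · simp [qBinom_eq_zero_of_lt (show N < k by omega),
            qBinom_eq_zero_of_lt (show N < k + 1 by omega),
            qBinom_eq_zero_of_lt (show N + 1 < k + 1 by omega)]

end Shuffle

/-! ### Permutations as shuffles: fixed points and maximal letters. -/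

section Permutations
open Polynomial Finset Equiv
open scoped Classical

/-- The descent predicate of a permutation of `Fin k`, extended by `T` beyond the last letter. -/
def PermDescent {k : ℕ} (T : ℕ → Prop) (σ : Perm (Fin k)) (r : ℕ) : Prop :=
  if h : r + 1 < k then σ ⟨r + 1, h⟩ < σ ⟨r, by omega⟩ else T r

lemma majorIndex_eq_wordMaj {N : ℕ} {π : Perm (Fin (N + 1))} {D : ℕ → Prop}
    (h : ∀ i (hi : i < N), (π ⟨i + 1, by omega⟩ < π ⟨i, by omega⟩ ↔ D i)) :
    majorIndex π = wordMaj D N := by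
  rw [majorIndex, wordMaj, Fin.sum_univ_castSucc, Finset.sum_range]
  simp only [Fin.val_castSucc, Fin.val_last, Nat.lt_irrefl, IsEmpty.exists_iff, if_false,
    add_zero, Nat.add_lt_add_iff_right]
  refine sum_congr rfl fun i _ => ?_
  simp only [← h i i.isLt, i.isLt, exists_true_left]
  rfl

lemma majorIndex_eq_wordMaj_permDescent {k : ℕ} (T : ℕ → Prop) (σ : Perm (Fin k)) :
    majorIndex σ = wordMaj (PermDescent T σ) (k - 1) := by
  cases k with
  | zero => simp [majorIndex, wordMaj]
  | succ k =>
    refine majorIndex_eq_wordMaj fun i hi => ?_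
    simp [PermDescent, hi]

lemma count_orderEmbOfFin {n k : ℕ} (A : Finset (Fin n)) (hA : #A = k) (a : Fin k) :
    Nat.count (· ∈ A.map Fin.valEmbedding) (A.orderEmbOfFin hA a) = a := by
  rw [Nat.count_eq_card_filter_range]
  have : {x ∈ range (A.orderEmbOfFin hA a : ℕ) | x ∈ A.map Fin.valEmbedding} =
      (Iio a).map ((A.orderEmbOfFin hA).toEmbedding.trans Fin.valEmbedding) := by
    ext x
    simp only [mem_filter, mem_range, mem_map, mem_Iio, Fin.valEmbedding_apply,
      Function.Embedding.trans_apply, RelEmbedding.coe_toEmbedding]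
    constructor
    · rintro ⟨h, y, hy, rfl⟩
      obtain ⟨b, rfl⟩ : y ∈ Set.range (A.orderEmbOfFin hA) := by simpa using hy
      exact ⟨b, (A.orderEmbOfFin hA).lt_iff_lt.1 h, rfl⟩
    · rintro ⟨b, hb, rfl⟩
      exact ⟨(A.orderEmbOfFin hA).lt_iff_lt.2 hb, _, orderEmbOfFin_mem A hA b, rfl⟩
  rw [this, card_map, Fin.card_Iio]

lemma count_succ_of_notMem {A : Finset ℕ} {i : ℕ} (h : i ∉ A) :
    Nat.count (· ∈ A) (i + 1) = Nat.count (· ∈ A) i := by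
  simp [Nat.count_succ, h]

/-- If the letters of `π` at the positions in `A` form the word `σ`, and the remaining letters
behave like copies of a single letter, then the major index of `π` is that of a shuffle. -/
lemma majorIndex_eq_wordMaj_shuffle {N k : ℕ} (π : Perm (Fin (N + 1))) (σ : Perm (Fin k))
    (A : Finset (Fin (N + 1))) (hA : #A = k) (T : ℕ → Prop)
    (hσ : ∀ a b : Fin k, (b : ℕ) = a + 1 →
      (A.orderEmbOfFin hA b : ℕ) = A.orderEmbOfFin hA a + 1 →
      (π (A.orderEmbOfFin hA b) < π (A.orderEmbOfFin hA a) ↔ σ b < σ a))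
    (hT : ∀ (a : Fin k) (j), j ∉ A → (j : ℕ) = A.orderEmbOfFin hA a + 1 →
      (π j < π (A.orderEmbOfFin hA a) ↔ T a))
    (hT' : ∀ (a : Fin k) (j), j ∉ A → (A.orderEmbOfFin hA a : ℕ) = j + 1 →
      (π (A.orderEmbOfFin hA a) < π j ↔ ¬ T a))
    (hA' : ∀ i j, i ∉ A → j ∉ A → (j : ℕ) = i + 1 → ¬ π j < π i) :
    majorIndex π =
      wordMaj (ShuffleDescent (PermDescent T σ) T (A.map Fin.valEmbedding)) N := by
  refine majorIndex_eq_wordMaj fun i hi => ?_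
  have hmem : ∀ j (hj : j < N + 1), (j ∈ A.map Fin.valEmbedding ↔ (⟨j, hj⟩ : Fin (N + 1)) ∈ A) := by
    intro j hj
    simp only [mem_map, Fin.valEmbedding_apply]
    exact ⟨fun ⟨x, hx, h⟩ => by subst h; exact hx, fun h => ⟨_, h, rfl⟩⟩
  have hr : ∀ x, x ∈ A → ∃ a, A.orderEmbOfFin hA a = x := fun x hx => by
    have : x ∈ Set.range (A.orderEmbOfFin hA) := by simpa using hx
    exact this
  have h₁ := hmem i (by omega)
  have h₂ := hmem (i + 1) (by omega)
  by_cases m₁ : (⟨i, by omega⟩ : Fin (N + 1)) ∈ A <;>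
    by_cases m₂ : (⟨i + 1, by omega⟩ : Fin (N + 1)) ∈ A
  · obtain ⟨a, ha⟩ := hr _ m₁
    obtain ⟨b, hb⟩ := hr _ m₂
    have ca := count_orderEmbOfFin A hA a
    have cb := count_orderEmbOfFin A hA b
    rw [ha] at ca
    rw [hb] at cb
    simp only at ca cb
    have hab : (b : ℕ) = a + 1 := by
      rw [← ca, ← cb, Nat.count_succ, if_pos (h₁.2 m₁)]
    have hd := hσ a b hab (by rw [ha, hb])
    rw [ha, hb] at hd
    have hlt : (a : ℕ) + 1 < k := hab ▸ b.isLt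
    have hb' : b = ⟨a + 1, hlt⟩ := Fin.ext hab
    rw [hd, ShuffleDescent, ca, PermDescent, dif_pos hlt, ← hb']
    simp [h₁.2 m₁, h₂.2 m₂]
  · obtain ⟨a, ha⟩ := hr _ m₁
    have ca := count_orderEmbOfFin A hA a
    rw [ha] at ca
    have hd := hT a _ m₂ (by rw [ha])
    rw [ha] at hd
    rw [hd, ShuffleDescent, ca]
    simp [h₁.2 m₁, mt h₂.1 m₂]
  · obtain ⟨b, hb⟩ := hr _ m₂
    have cb := count_orderEmbOfFin A hA b
    rw [hb] at cb
    simp only [count_succ_of_notMem (mt h₁.1 m₁)] at cb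
    have hd := hT' b _ m₁ (by rw [hb])
    rw [hb] at hd
    rw [hd, ShuffleDescent, cb]
    simp [mt h₁.1 m₁, h₂.2 m₂]
  · have hd := hA' _ _ m₁ m₂ rfl
    rw [ShuffleDescent]
    simp only [mt h₁.1 m₁, mt h₂.1 m₂, false_and, and_false, or_self, iff_false]
    exact hd

lemma sum_powersetCard_univ_map_val {M : Type*} [AddCommMonoid M] (f : Finset ℕ → M) (n k : ℕ) :
    ∑ A ∈ powersetCard k (univ : Finset (Fin n)), f (A.map Fin.valEmbedding) =
      ∑ A ∈ powersetCard k (range n), f A := by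
  have h : range n = (univ : Finset (Fin n)).map Fin.valEmbedding := by
    simp [Nat.Iio_eq_range]
  rw [h, powersetCard_map, sum_map]
  rfl

lemma sum_pow_wordMaj_permDescent {k : ℕ} (T : ℕ → Prop) (σ : Perm (Fin k))
    (hTD : ∀ a b : Fin k, (b : ℕ) = a + 1 → T a → ¬ T b → σ b < σ a)
    (hDT : ∀ a b : Fin k, (b : ℕ) = a + 1 → ¬ T a → T b → ¬ σ b < σ a) (N : ℕ) :
    ∑ A ∈ powersetCard k (univ : Finset (Fin (N + 1))),
        (X : Polynomial ℤ) ^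
          wordMaj (ShuffleDescent (PermDescent T σ) T (A.map Fin.valEmbedding)) N =
      X ^ majorIndex σ * qBinom (N + 1) k := by
  rw [majorIndex_eq_wordMaj_permDescent T, ← sum_pow_wordMaj_shuffle,
    sum_powersetCard_univ_map_val
      (fun A => (X : Polynomial ℤ) ^ wordMaj (ShuffleDescent (PermDescent T σ) T A) N)]
  · intro r h₁ h₂
    -- Past the last letter the descent predicate is `T` itself, so both compatibility conditions
    -- hold there automatically.
    rw [PermDescent]
    split_ifs with h
    · exact hTD ⟨r, by omega⟩ ⟨r + 1, h⟩ rfl h₁ h₂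
    · exact h₁
  · intro r h₁ h₂
    rw [PermDescent]
    split_ifs with h
    · exact hDT ⟨r, by omega⟩ ⟨r + 1, h⟩ rfl h₁ h₂
    · exact h₁

/-- The letter at position `r` of `σ` is an excedance. -/
def IsExcedance {k : ℕ} (σ : Perm (Fin k)) (r : ℕ) : Prop := ∃ h : r < k, ⟨r, h⟩ < σ ⟨r, h⟩

lemma isExcedance_val {k : ℕ} {σ : Perm (Fin k)} {a : Fin k} : IsExcedance σ a ↔ a < σ a := by
  simp [IsExcedance]

/-- The permutation whose non-fixed points form the set `A`, on which it acts like `σ`. -/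
noncomputable def extendByFixedPoints {n k : ℕ} (A : Finset (Fin n)) (hA : #A = k)
    (σ : Perm (Fin k)) : Perm (Fin n) :=
  σ.extendDomain (A.orderIsoOfFin hA).toEquiv

lemma extendByFixedPoints_apply_orderEmbOfFin {n k : ℕ} (A : Finset (Fin n)) (hA : #A = k)
    (σ : Perm (Fin k)) (a : Fin k) :
    extendByFixedPoints A hA σ (A.orderEmbOfFin hA a) = A.orderEmbOfFin hA (σ a) :=
  Perm.extendDomain_apply_image σ (A.orderIsoOfFin hA).toEquiv a

lemma extendByFixedPoints_apply_of_notMem {n k : ℕ} (A : Finset (Fin n)) (hA : #A = k)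
    (σ : Perm (Fin k)) {j : Fin n} (hj : j ∉ A) : extendByFixedPoints A hA σ j = j :=
  Perm.extendDomain_apply_not_subtype σ _ hj

/-- A non-fixed letter never takes the value of an adjacent fixed point, nor its own position.
Comparing it with that fixed point is therefore the same as comparing it with its own position, that
is, testing for an excedance. -/
lemma majorIndex_extendByFixedPoints {N k : ℕ} (A : Finset (Fin (N + 1))) (hA : #A = k)
    {σ : Perm (Fin k)} (hσ : σ ∈ derangements (Fin k)) :
    majorIndex (extendByFixedPoints A hA σ) =
      wordMaj (ShuffleDescent (PermDescent (IsExcedance σ) σ) (IsExcedance σ)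
        (A.map Fin.valEmbedding)) N := by
  have hne : ∀ a j, j ∉ A → A.orderEmbOfFin hA a ≠ j := fun a j hj h =>
    hj (h ▸ orderEmbOfFin_mem A hA a)
  refine majorIndex_eq_wordMaj_shuffle _ σ A hA _ ?_ ?_ ?_ ?_
  · intro a b _ _
    simp only [extendByFixedPoints_apply_orderEmbOfFin, OrderEmbedding.lt_iff_lt]
  · intro a j hj hja
    rw [extendByFixedPoints_apply_orderEmbOfFin, extendByFixedPoints_apply_of_notMem _ _ _ hj,
      isExcedance_val, ← (A.orderEmbOfFin hA).lt_iff_lt]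
    have := hne (σ a) j hj
    rw [Ne, Fin.ext_iff] at this
    rw [Fin.lt_def, Fin.lt_def]
    omega
  · intro a j hj hja
    rw [extendByFixedPoints_apply_orderEmbOfFin, extendByFixedPoints_apply_of_notMem _ _ _ hj,
      isExcedance_val, ← (A.orderEmbOfFin hA).lt_iff_lt]
    have h₁ := hne (σ a) j hj
    have h₂ : A.orderEmbOfFin hA (σ a) ≠ A.orderEmbOfFin hA a :=
      fun h => hσ a ((A.orderEmbOfFin hA).injective h)
    rw [Ne, Fin.ext_iff] at h₁ h₂
    rw [Fin.lt_def, Fin.lt_def]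
    omega
  · intro i j hi hj hij
    rw [extendByFixedPoints_apply_of_notMem _ _ _ hi, extendByFixedPoints_apply_of_notMem _ _ _ hj,
      Fin.lt_def]
    omega

lemma sum_support_eq {n k : ℕ} (A : Finset (Fin n)) (hA : #A = k) {M : Type*} [AddCommMonoid M]
    (f : Perm (Fin n) → M) :
    ∑ π with π.support = A, f π =
      ∑ σ : Perm (Fin k) with σ ∈ derangements (Fin k), f (extendByFixedPoints A hA σ) := by
  symm
  refine sum_bij (fun σ _ => extendByFixedPoints A hA σ) ?_ ?_ ?_ fun _ _ => rfl
  · intro σ hσ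
    have hσ : σ ∈ derangements (Fin k) := by simpa using hσ
    rw [mem_filter]
    refine ⟨mem_univ _, ?_⟩
    ext x
    rw [Perm.mem_support]
    constructor
    · contrapose!
      exact extendByFixedPoints_apply_of_notMem A hA σ
    · intro hx
      obtain ⟨a, rfl⟩ : x ∈ Set.range (A.orderEmbOfFin hA) := by simpa using hx
      rw [extendByFixedPoints_apply_orderEmbOfFin]
      exact fun h => hσ a ((A.orderEmbOfFin hA).injective h)
  · intro σ _ τ _ h
    exact Perm.extendDomainHom_injective (A.orderIsoOfFin hA).toEquiv h
  · intro π hπ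
    have hπ : π.support = A := by simpa using hπ
    subst hπ
    let e := (π.support.orderIsoOfFin hA).toEquiv
    let τ : Perm π.support := π.subtypePerm fun _ => Perm.apply_mem_support
    have key : ∀ a, π.support.orderEmbOfFin hA (e.symm.permCongr τ a) =
        π (π.support.orderEmbOfFin hA a) := by
      intro a
      change ((e (e.symm (τ (e a))) : π.support) : Fin n) = π (e a)
      rw [Equiv.apply_symm_apply]
      rfl
    refine ⟨e.symm.permCongr τ, ?_, ?_⟩
    · rw [mem_filter]
      refine ⟨mem_univ _, fun a ha => ?_⟩
      have h := key a
      rw [ha] at h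
      exact Perm.mem_support.1 (orderEmbOfFin_mem π.support hA a) h.symm
    · ext1 x
      by_cases hx : x ∈ π.support
      · obtain ⟨a, rfl⟩ : x ∈ Set.range (π.support.orderEmbOfFin hA) := by simpa using hx
        rw [extendByFixedPoints_apply_orderEmbOfFin, key]
      · rw [extendByFixedPoints_apply_of_notMem _ _ _ hx]
        exact (Perm.notMem_support.1 hx).symm

/-- The generating function of the permutations of `Fin n` by major index. -/
noncomputable def permMajSum (n : ℕ) : Polynomial ℤ := ∑ π : Perm (Fin n), X ^ majorIndex π

/-- Sorting the permutations by their sets of fixed points. -/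
lemma permMajSum_eq_sum_qDerangement (N : ℕ) :
    permMajSum (N + 1) = ∑ k ∈ range (N + 2), qBinom (N + 1) k * qDerangement k := by
  rw [permMajSum, ← sum_fiberwise univ (fun π : Perm (Fin (N + 1)) => π.support), ← powerset_univ,
    sum_powerset, card_univ, Fintype.card_fin]
  refine sum_congr rfl fun k _ => ?_
  have h : ∀ A ∈ powersetCard k (univ : Finset (Fin (N + 1))),
      ∑ π : Perm (Fin (N + 1)) with π.support = A, (X : Polynomial ℤ) ^ majorIndex π =
        ∑ σ : Perm (Fin k) with σ ∈ derangements (Fin k),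
          X ^ wordMaj (ShuffleDescent (PermDescent (IsExcedance σ) σ) (IsExcedance σ)
            (A.map Fin.valEmbedding)) N := by
    intro A hA
    rw [sum_support_eq A (mem_powersetCard.1 hA).2]
    refine sum_congr rfl fun σ hσ => ?_
    rw [majorIndex_extendByFixedPoints _ _ (mem_filter.1 hσ).2]
  rw [sum_congr rfl h, sum_comm, qDerangement, mul_sum]
  refine sum_congr rfl fun σ hσ => ?_
  have hσ := (mem_filter.1 hσ).2
  rw [sum_pow_wordMaj_permDescent, mul_comm]
  -- A non-excedance `b = a + 1` of a derangement has `σ b < b`, so `σ b ≤ a < σ a`.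
  · intro a b hab ha hb
    rw [isExcedance_val] at ha hb
    have h₁ : σ b ≠ b := hσ b
    rw [Ne, Fin.ext_iff] at h₁
    rw [Fin.lt_def] at *
    omega
  · intro a b hab ha hb
    rw [isExcedance_val] at ha hb
    rw [Fin.lt_def] at *
    omega

/-- Insertion of a maximal letter at the position `p` of a permutation. -/
def insertMax {n : ℕ} (p : Fin (n + 1)) (σ : Perm (Fin n)) : Perm (Fin (n + 1)) :=
  (finSuccEquiv' p).trans ((optionCongr σ).trans (finSuccEquiv' (Fin.last n)).symm)

lemma insertMax_apply_self {n : ℕ} (p : Fin (n + 1)) (σ : Perm (Fin n)) :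
    insertMax p σ p = Fin.last n := by
  simp [insertMax]

lemma insertMax_apply_succAbove {n : ℕ} (p : Fin (n + 1)) (σ : Perm (Fin n)) (i : Fin n) :
    insertMax p σ (p.succAbove i) = (σ i).castSucc := by
  simp [insertMax]

lemma insertMax_bijective (n : ℕ) :
    Function.Bijective (fun x : Fin (n + 1) × Perm (Fin n) => insertMax x.1 x.2) := by
  rw [Fintype.bijective_iff_injective_and_card]
  constructor
  · rintro ⟨p, σ⟩ ⟨p', σ'⟩ h
    simp only at h
    obtain rfl : p = p' := (insertMax p σ).injective
      ((insertMax_apply_self p σ).trans (by rw [h, insertMax_apply_self]))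
    refine Prod.ext rfl (Equiv.ext fun i => ?_)
    have := insertMax_apply_succAbove p σ i
    rw [h, insertMax_apply_succAbove] at this
    exact (Fin.castSucc_injective n this).symm
  · simp [Fintype.card_perm, Nat.factorial_succ]

/-- A shuffle with one copy of a letter that nothing exceeds, so the predicate `T` is constantly
false. -/
lemma majorIndex_insertMax {n : ℕ} (p : Fin (n + 1)) (σ : Perm (Fin n)) :
    majorIndex (insertMax p σ) = wordMaj (ShuffleDescent (PermDescent (fun _ => False) σ)
      (fun _ => False) (({p}ᶜ : Finset (Fin (n + 1))).map Fin.valEmbedding)) n := by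
  have hA : #({p}ᶜ : Finset (Fin (n + 1))) = n := by simp [card_compl]
  have he : ∀ a, ({p}ᶜ : Finset (Fin (n + 1))).orderEmbOfFin hA a = p.succAbove a := by
    intro a
    have := orderEmbOfFin_unique hA (f := p.succAbove) (by simp [Fin.succAbove_ne])
      (Fin.strictMono_succAbove p)
    rw [this]
  refine majorIndex_eq_wordMaj_shuffle _ σ _ hA _ ?_ ?_ ?_ ?_
  · intro a b _ _
    rw [he, he, insertMax_apply_succAbove, insertMax_apply_succAbove, Fin.castSucc_lt_castSucc_iff]
  · intro a j hj _
    obtain rfl : j = p := by simpa using hj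
    rw [insertMax_apply_self]
    simp [Fin.le_last]
  · intro a j hj _
    obtain rfl : j = p := by simpa using hj
    rw [he, insertMax_apply_self, insertMax_apply_succAbove]
    simp [Fin.castSucc_lt_last]
  · intro i j hi hj hij
    obtain rfl : i = p := by simpa using hi
    obtain rfl : j = i := by simpa using hj
    omega

/-- MacMahon's recursion for the major index. -/
lemma permMajSum_succ (n : ℕ) :
    permMajSum (n + 1) = (∑ i ∈ range (n + 1), X ^ i) * permMajSum n := by
  rw [permMajSum, ← (Equiv.ofBijective _ (insertMax_bijective n)).sum_comp, Fintype.sum_prod_type,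
    sum_comm, permMajSum, mul_sum]
  refine sum_congr rfl fun σ _ => ?_
  have h := sum_pow_wordMaj_permDescent (fun _ => False) σ (by simp) (by simp) n
  rw [qBinom_succ_self] at h
  rw [mul_comm, ← h]
  refine sum_bij (fun p _ => ({p}ᶜ : Finset (Fin (n + 1)))) ?_ ?_ ?_ ?_
  · simp [mem_powersetCard, card_compl]
  · intro p _ p' _ h
    simpa using h
  · intro A hA
    have hc : #Aᶜ = 1 := by
      rw [card_compl, (mem_powersetCard.1 hA).2]
      simp
    obtain ⟨p, hp⟩ := card_eq_one.1 hc
    exact ⟨p, mem_univ _, by rw [← hp, compl_compl]⟩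
  · intro p _
    rw [← majorIndex_insertMax]
    rfl

end Permutations

/-! ### The recurrence for the `q`-derangement numbers. -/

section Recurrence
open Polynomial Finset

lemma qDerangement_zero : qDerangement 0 = 1 := by
  classical
  rw [qDerangement, filter_true_of_mem (fun π _ i => i.elim0)]
  simp [majorIndex]

lemma permMajSum_zero : permMajSum 0 = 1 := by
  simp [permMajSum, majorIndex]

lemma sum_qBinom_mul_qDerangement (n : ℕ) :
    ∑ k ∈ range (n + 1), qBinom n k * qDerangement k = permMajSum n := by
  cases n with
  | zero => simp [qDerangement_zero, permMajSum_zero]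
  | succ n => exact (permMajSum_eq_sum_qDerangement n).symm

/-- The recurrence `d_{n+1}(q) = [n+1] d_n(q) + (-1)^{n+1} q^{n(n+1)/2}`. -/
lemma qDerangement_succ (n : ℕ) : qDerangement (n + 1) =
    (∑ i ∈ range (n + 1), X ^ i) * qDerangement n + (-1) ^ (n + 1) * X ^ (n + 1).choose 2 := by
  induction n using Nat.strong_induction_on with
  | _ n ih =>
    -- Absorption turns `[n+1]` times the identity for `n` into `∑ qBinom (n+1) (k+1) * [k+1] *
    -- d_k`. Comparing this with the identity for `n + 1`, the induction hypothesis handles the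
    -- terms with `k < n`, and the alternating sum `h₃` absorbs `d_0 = 1`, leaving the recurrence at
    -- `k = n`.
    have h₁ := sum_qBinom_mul_qDerangement (n + 1)
    rw [permMajSum_succ, ← sum_qBinom_mul_qDerangement n, sum_range_succ', mul_sum,
      qDerangement_zero] at h₁
    have h₂ : ∀ k ∈ range (n + 1),
        (∑ i ∈ range (n + 1), (X : Polynomial ℤ) ^ i) * (qBinom n k * qDerangement k) =
          qBinom (n + 1) (k + 1) * ((∑ i ∈ range (k + 1), X ^ i) * qDerangement k) := by
      intro k hk
      have := geom_sum_mul_qBinom_succ_succ (show k ≤ n by simpa [Nat.lt_succ_iff] using hk)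
      linear_combination (-qDerangement k) * this
    have h₃ := sum_neg_one_pow_mul_qBinom n
    have h₄ : ∀ k ∈ range n, qBinom (n + 1) (k + 1) * qDerangement (k + 1) =
        qBinom (n + 1) (k + 1) * ((∑ i ∈ range (k + 1), X ^ i) * qDerangement k) +
          (-1) ^ (k + 1) * X ^ (k + 1).choose 2 * qBinom (n + 1) (k + 1) := by
      intro k hk
      rw [ih k (mem_range.1 hk)]
      ring
    rw [sum_congr rfl h₂, sum_range_succ, sum_congr rfl h₄, sum_add_distrib,
      sum_range_succ _ n] at h₁
    rw [sum_range_succ] at h₃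
    simp only [qBinom_self, qBinom_zero_right, one_mul, mul_one] at h₁ h₃
    linear_combination h₁ - h₃

/-- The coefficients of the `q`-derangement numbers, extended by zero to negative indices. -/
noncomputable def derangementCoeff (n : ℕ) (k : ℤ) : ℤ :=
  if 0 ≤ k then (qDerangement n).coeff k.toNat else 0

lemma derangementCoeff_natCast (n k : ℕ) :
    derangementCoeff n k = (qDerangement n).coeff k := by
  simp [derangementCoeff]

lemma derangementCoeff_succ (n : ℕ) (k : ℤ) : derangementCoeff (n + 1) k =
    ∑ j ∈ range (n + 1), derangementCoeff n (k - j) +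
      if k = (n + 1).choose 2 then (-1) ^ (n + 1) else 0 := by
  rcases lt_or_ge k 0 with hk | hk
  · rw [derangementCoeff, if_neg (by omega), if_neg (by omega), add_zero]
    symm
    refine sum_eq_zero fun j _ => ?_
    rw [derangementCoeff, if_neg (by omega)]
  · obtain ⟨k, rfl⟩ := Int.eq_ofNat_of_zero_le hk
    rw [derangementCoeff_natCast, qDerangement_succ, coeff_add, sum_mul, finsetSum_coeff]
    congr 1
    · refine sum_congr rfl fun j _ => ?_
      rw [coeff_X_pow_mul', derangementCoeff]
      by_cases h : j ≤ k
      · rw [if_pos h, if_pos (by omega)]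
        congr 1
        omega
      · rw [if_neg h, if_neg (by omega)]
    · have : ((-1 : Polynomial ℤ) ^ (n + 1)) = C ((-1) ^ (n + 1)) := by simp
      rw [this, coeff_C_mul, coeff_X_pow]
      simp [Nat.cast_inj]

end Recurrence

/-! ### Log-concavity of window sums. -/

section LogConcavity
open Finset

/-- The sequence `a 1, …, a m` is positive and strictly log-concave. -/
def LogConcaveUpTo (a : ℤ → ℤ) (m : ℤ) : Prop :=
  (∀ k, 1 ≤ k → k ≤ m → 0 < a k) ∧ ∀ k, 1 < k → k < m → a (k - 1) * a (k + 1) < a k ^ 2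

/-- The difference `a i * a j - a (i - 1) * a (j + 1)`. -/
def crossDiff (a : ℤ → ℤ) (i j : ℤ) : ℤ := a i * a j - a (i - 1) * a (j + 1)

/-- The sum of the last `n` terms of a sequence up to the index `k`. -/
def windowSum (a : ℤ → ℤ) (n : ℕ) (k : ℤ) : ℤ := ∑ j ∈ range n, a (k - j)

/-- Let `U` and `V` be the sums of `a (k - j)` and `a (k - 1 - j)` over `j < s`. The window sum at
`k` is both `U + a (k - s)` and `V + a k`; its neighbours are `U + a (k + 1)` and `V + a (k - s -
1)`. Using one form for each factor of the square makes `U * V` cancel. -/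
lemma windowSum_sq_sub (a : ℤ → ℤ) (s : ℕ) (k : ℤ) :
    windowSum a (s + 1) k ^ 2 - windowSum a (s + 1) (k - 1) * windowSum a (s + 1) (k + 1) =
      crossDiff a (k - s) k + ∑ j ∈ range s, crossDiff a (k - j) k +
        ∑ j ∈ range s, crossDiff a (k - s) (k - 1 - j) := by
  have h₁ : windowSum a (s + 1) k = ∑ j ∈ range s, a (k - j) + a (k - s) := by
    rw [windowSum, sum_range_succ]
  have h₂ : windowSum a (s + 1) k = ∑ j ∈ range s, a (k - 1 - j) + a k := by
    rw [windowSum, sum_range_succ']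
    congr 1
    · refine sum_congr rfl fun j _ => congrArg a ?_
      push_cast; ring
    · simp
  have h₃ : windowSum a (s + 1) (k + 1) = ∑ j ∈ range s, a (k - j) + a (k + 1) := by
    rw [windowSum, sum_range_succ']
    congr 1
    · refine sum_congr rfl fun j _ => congrArg a ?_
      push_cast; ring
    · simp
  have h₄ : windowSum a (s + 1) (k - 1) = ∑ j ∈ range s, a (k - 1 - j) + a (k - s - 1) := by
    rw [windowSum, sum_range_succ, sub_right_comm k 1 (s : ℤ)]
  have h₅ : ∑ j ∈ range s, crossDiff a (k - j) k =
      (∑ j ∈ range s, a (k - j)) * a k - (∑ j ∈ range s, a (k - 1 - j)) * a (k + 1) := by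
    rw [sum_mul, sum_mul, ← sum_sub_distrib]
    refine sum_congr rfl fun j _ => ?_
    rw [crossDiff, sub_right_comm k (j : ℤ) 1]
  have h₆ : ∑ j ∈ range s, crossDiff a (k - s) (k - 1 - j) =
      a (k - s) * (∑ j ∈ range s, a (k - 1 - j)) -
        a (k - s - 1) * (∑ j ∈ range s, a (k - j)) := by
    rw [mul_sum, mul_sum, ← sum_sub_distrib]
    refine sum_congr rfl fun j _ => ?_
    rw [crossDiff, show k - 1 - (j : ℤ) + 1 = k - j by ring]
  rw [h₅, h₆, h₃, h₄, sq]
  nth_rewrite 1 [h₁]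
  rw [h₂, crossDiff]
  ring

/-- The ratios `a (k - 1) / a k` increase, so the inequality at `j` multiplied by the diagonal one
at `j + 1` gives the next. The condition `a 0 = 0` supplies the diagonal inequality at index `1`. -/
lemma LogConcaveUpTo.crossDiff_pos {a : ℤ → ℤ} {m : ℤ} (h : LogConcaveUpTo a m) (h0 : a 0 = 0)
    {i j : ℤ} (hi : 1 ≤ i) (hij : i ≤ j) (hj : j < m) : 0 < crossDiff a i j := by
  obtain ⟨hp, hl⟩ := h
  have diag : ∀ k, 1 ≤ k → k < m → a (k - 1) * a (k + 1) < a k * a k := by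
    intro k hk hkm
    rcases hk.eq_or_lt with rfl | hk
    · have := hp 1 le_rfl hkm.le
      rw [sub_self, h0, zero_mul]
      positivity
    · rw [← sq]
      exact hl k hk hkm
  induction j, hij using Int.leInduction with
  | base => exact sub_pos.2 (diag i hi hj)
  | succ j hij ih =>
    have ih := ih (by omega)
    rw [crossDiff, sub_pos] at ih ⊢
    have hd := diag (j + 1) (by omega) hj
    rw [add_sub_cancel_right] at hd
    have p₀ := hp i hi (by omega)
    have p₁ := hp j (by omega) (by omega)
    have p₂ := hp (j + 1) (by omega) (by omega)
    have p₃ := hp (j + 1 + 1) (by omega) (by omega)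
    have q : 0 ≤ a (i - 1) := by
      rcases hi.eq_or_lt with rfl | hi
      · simp [h0]
      · exact (hp (i - 1) (by omega) (by omega)).le
    have hmul := mul_lt_mul'' ih hd (by positivity) (by positivity)
    refine lt_of_mul_lt_mul_right ?_ (mul_pos p₁ p₂).le
    linear_combination hmul

/-- Window sums preserve strict log-concavity, even if the log-concavity of the sequence fails at
the single index `m`, provided that this failure is compensated. -/
lemma windowSum_logConcaveUpTo {a : ℤ → ℤ} {m : ℤ} {s : ℕ} (hs : 1 ≤ s) (hsm : s ≤ m)
    (h0 : ∀ k, 0 ≤ a k) (hp : ∀ k, 1 ≤ k → k ≤ m → 0 < a k)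
    (hd : ∀ k, 1 ≤ k → k < m → 0 < crossDiff a k k)
    (hc : ∀ i j, i ≤ j → ¬(i = m ∧ j = m) → 0 ≤ crossDiff a i j)
    (hm : 0 < ∑ j ∈ range s, crossDiff a (m - j) m) :
    LogConcaveUpTo (windowSum a (s + 1)) (m + s) := by
  constructor
  · intro k hk hkm
    refine sum_pos' (fun j _ => h0 _) ?_
    rcases le_or_gt k m with h | h
    · exact ⟨0, by simp, hp _ (by simpa using hk) (by simpa using h)⟩
    · exact ⟨(k - m).toNat, by rw [mem_range]; omega, hp _ (by omega) (by omega)⟩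
  · intro k hk hkm
    rw [← sub_pos, windowSum_sq_sub]
    have t₁ : 0 ≤ crossDiff a (k - s) k := hc _ _ (by omega) (by omega)
    have t₃ : 0 ≤ ∑ j ∈ range s, crossDiff a (k - s) (k - 1 - j) :=
      sum_nonneg fun j hj => hc _ _ (by rw [mem_range] at hj; omega) (by omega)
    -- The bad pair `(m, m)` can occur only in the first sum, at `k = m`, where `hm` compensates.
    -- Elsewhere strictness comes from a diagonal term below `m`: `(k, k)` if `k < m`, and `(k - s,
    -- k - s)` if `k > m`.
    rcases lt_trichotomy k m with h | rfl | h
    · have t₂ : 0 < ∑ j ∈ range s, crossDiff a (k - j) k := by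
        refine sum_pos' (fun j _ => hc _ _ (by omega) (by omega)) ⟨0, by rw [mem_range]; omega, ?_⟩
        simpa using hd k (by omega) h
      linarith
    · linarith
    · have t₂ : 0 ≤ ∑ j ∈ range s, crossDiff a (k - j) k :=
        sum_nonneg fun j _ => hc _ _ (by omega) (by omega)
      have t₃ : 0 < ∑ j ∈ range s, crossDiff a (k - s) (k - 1 - j) := by
        refine sum_pos' (fun j hj => hc _ _ (by rw [mem_range] at hj; omega) (by omega))
          ⟨s - 1, by rw [mem_range]; omega, ?_⟩
        rw [show k - 1 - ((s - 1 : ℕ) : ℤ) = k - s by omega]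
        exact hd _ (by omega) (by omega)
      linarith

/-- The last values of the window sums of a sequence which vanishes above the index `m`. -/
lemma windowSum_eq_of_forall_gt {a : ℤ → ℤ} {m : ℤ} (ha : ∀ k, m < k → a k = 0) {s t : ℕ}
    (hts : t ≤ s) : windowSum a (s + 1) (m + s - t) = ∑ i ∈ range (t + 1), a (m - i) := by
  have h : ∑ i ∈ range (t + 1), a (m - i) = ∑ i ∈ range (t + 1), a (m - t + i) := by
    rw [← sum_range_reflect]
    refine sum_congr rfl fun i hi => congrArg a ?_
    rw [mem_range] at hi
    omega
  rw [h, windowSum, ← sum_range_reflect]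
  symm
  have h' : ∀ i ∈ range (t + 1), a (m - t + i) = a (m + s - t - ((s + 1 - 1 - i : ℕ) : ℤ)) := by
    intro i hi
    rw [mem_range] at hi
    congr 1
    omega
  rw [sum_congr rfl h']
  refine sum_subset (range_subset_range.2 (by omega)) fun i hi hi' => ha _ ?_
  rw [mem_range] at hi hi'
  omega

lemma windowSum_eq_zero_of_gt {a : ℤ → ℤ} {m : ℤ} (ha : ∀ k, m < k → a k = 0) {s : ℕ} {k : ℤ}
    (hk : m + s < k) : windowSum a (s + 1) k = 0 :=
  sum_eq_zero fun j hj => ha _ (by rw [mem_range] at hj; omega)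

lemma windowSum_eq_zero_of_nonpos {a : ℤ → ℤ} (ha : ∀ k, k ≤ 0 → a k = 0) {n : ℕ} {k : ℤ}
    (hk : k ≤ 0) : windowSum a n k = 0 :=
  sum_eq_zero fun j _ => ha _ (by omega)

lemma LogConcaveUpTo.congr {a b : ℤ → ℤ} {m : ℤ} (h : LogConcaveUpTo a m)
    (hab : ∀ k, k ≤ m → b k = a k) : LogConcaveUpTo b m := by
  refine ⟨fun k h₁ h₂ => ?_, fun k h₁ h₂ => ?_⟩
  · rw [hab k h₂]; exact h.1 k h₁ h₂
  · rw [hab k h₂.le, hab (k + 1) (by omega), hab (k - 1) (by omega)]; exact h.2 k h₁ h₂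

/-- The shape of the coefficients of `d_n(q)` for `n = 2 h`, where `m = n (n - 1) / 2 - 1`. -/
structure EvenProfile (a : ℤ → ℤ) (h m : ℤ) : Prop where
  zero_of_nonpos : ∀ k, k ≤ 0 → a k = 0
  zero_of_gt : ∀ k, m + 1 < k → a k = 0
  logConcave : LogConcaveUpTo a m
  last : a (m + 1) = 1
  val₀ : a m = h - 1
  val₁ : a (m - 1) = h * (h - 1)
  val₂ : a (m - 2) ≤ h * (h - 1) ^ 2
  val₃ : 0 < (h - 1) ^ 2 - h * (h - 1) + (h * (h - 1) ^ 2 - a (m - 2)) +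
    ((h - 1) * a (m - 2) - a (m - 3))

/-- The shape of the coefficients of `d_n(q)` for `n = 2 h - 1`, where `m = n (n - 1) / 2 - 1`. -/
structure OddProfile (a : ℤ → ℤ) (h m : ℤ) : Prop where
  zero_of_nonpos : ∀ k, k ≤ 0 → a k = 0
  zero_of_gt : ∀ k, m < k → a k = 0
  logConcave : LogConcaveUpTo a m
  val₀ : a m = h - 1
  val₁ : a (m - 1) = (h - 1) ^ 2
  val₂ : h * (h - 1) + a (m - 2) ≤ h * (h - 1) ^ 2
  val₃ : 0 < (h - 1) ^ 2 - h * (h - 1) + (h * (h - 1) ^ 2 - (h * (h - 1) + a (m - 2))) +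
    ((h - 1) * (h * (h - 1) + a (m - 2)) - (h * (h - 1) + a (m - 2) + a (m - 3)))

/-- Here no cross difference with `i ≤ j` is negative. The fields `val₂` and `val₃` of `OddProfile`
are those of `EvenProfile` written through the window sums `f₂` and `f₃`, so they transfer verbatim.
The correction `+1` creates the new last coefficient. -/
lemma OddProfile.evenProfile {a b : ℤ → ℤ} {h m : ℤ} {s : ℕ} (ha : OddProfile a h m) (hs : 3 ≤ s)
    (hsm : s ≤ m)
    (hb : ∀ k, b k = windowSum a (s + 1) k + if k = m + s + 1 then 1 else 0) :
    EvenProfile b h (m + s) := by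
  have hb' : ∀ k, k ≤ m + s → b k = windowSum a (s + 1) k := fun k hk => by
    rw [hb, if_neg (by omega), add_zero]
  have z := ha.zero_of_gt
  have h0 : ∀ k, 0 ≤ a k := fun k => by
    rcases le_or_gt k 0 with h | h
    · exact (ha.zero_of_nonpos k h).ge
    rcases le_or_gt k m with h' | h'
    · exact (ha.logConcave.1 k h h').le
    · exact (z k h').ge
  have hend : ∀ i j, 1 ≤ i → i ≤ j → j ≤ m → 0 < crossDiff a i j := by
    intro i j hi hij hj
    rcases hj.eq_or_lt with rfl | hj
    · rw [crossDiff, z (j + 1) (by omega), mul_zero, sub_zero]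
      exact mul_pos (ha.logConcave.1 i hi hij) (ha.logConcave.1 j (by omega) le_rfl)
    · exact ha.logConcave.crossDiff_pos (ha.zero_of_nonpos 0 le_rfl) hi hij hj
  have hc : ∀ i j, i ≤ j → 0 ≤ crossDiff a i j := by
    intro i j hij
    rcases le_or_gt i 0 with h | h
    · rw [crossDiff, ha.zero_of_nonpos i h, ha.zero_of_nonpos (i - 1) (by omega)]
      simp
    rcases le_or_gt j m with h' | h'
    · exact (hend i j h hij h').le
    · rw [crossDiff, z (j + 1) (by omega), mul_zero, sub_zero]
      exact mul_nonneg (h0 _) (h0 _)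
  have e₀ := windowSum_eq_of_forall_gt z (show 0 ≤ s by omega)
  have e₁ := windowSum_eq_of_forall_gt z (show 1 ≤ s by omega)
  have e₂ := windowSum_eq_of_forall_gt z (show 2 ≤ s by omega)
  have e₃ := windowSum_eq_of_forall_gt z (show 3 ≤ s by omega)
  have v₀ := ha.val₀
  have v₁ := ha.val₁
  have v₂ := ha.val₂
  have v₃ := ha.val₃
  simp only [sum_range_succ, sum_range_zero, Nat.cast_zero, Nat.cast_one, Nat.cast_ofNat, sub_zero,
    zero_add, v₀, v₁] at e₀ e₁ e₂ e₃
  have f₂ : b (m + s - 2) = h * (h - 1) + a (m - 2) := by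
    rw [hb' _ (by omega), e₂]; ring
  have f₃ : b (m + s - 3) = h * (h - 1) + a (m - 2) + a (m - 3) := by
    rw [hb' _ (by omega), e₃]; ring
  refine ⟨fun k hk => ?_, fun k hk => ?_, ?_, ?_, ?_, ?_, ?_, ?_⟩
  · rw [hb' k (by omega), windowSum_eq_zero_of_nonpos ha.zero_of_nonpos hk]
  · rw [hb, windowSum_eq_zero_of_gt z (by omega), if_neg (by omega), add_zero]
  · refine (windowSum_logConcaveUpTo (by omega) hsm h0 ha.logConcave.1
      (fun k h₁ h₂ => hend k k h₁ le_rfl h₂.le) (fun i j hij _ => hc i j hij) ?_).congr hb'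
    refine sum_pos' (fun j _ => hc _ _ (by omega)) ⟨0, by rw [mem_range]; omega, ?_⟩
    simpa using hend m m (by omega) le_rfl le_rfl
  · rw [hb, windowSum_eq_zero_of_gt z (by omega), if_pos rfl, zero_add]
  · rw [hb' _ le_rfl, e₀]
  · rw [hb' _ (by omega), e₁]; ring
  · rw [f₂]; exact v₂
  · rw [f₂, f₃]; exact v₃

/-- The one negative cross difference is `(h - 1)^2 - h * (h - 1)` at `(m, m)`. The field `val₃`
says that adding those at `(m - 1, m)` and `(m - 2, m)` makes the total positive; `val₂` makes the
cross differences at `(i, m)` with `i < m` nonnegative. The correction `-1` removes the last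
coefficient. -/
lemma EvenProfile.oddProfile {a b : ℤ → ℤ} {h m : ℤ} {s : ℕ} (ha : EvenProfile a h m) (hh : 3 ≤ h)
    (hs : 4 ≤ s) (hsm : s ≤ m)
    (hb : ∀ k, b k = windowSum a (s + 1) k + if k = m + s + 1 then -1 else 0) :
    OddProfile b (h + 1) (m + s) := by
  have hb' : ∀ k, k ≤ m + s → b k = windowSum a (s + 1) k := fun k hk => by
    rw [hb, if_neg (by omega), add_zero]
  have z := ha.zero_of_gt
  have v := ha.last
  have v₀ := ha.val₀
  have v₁ := ha.val₁
  have v₂ := ha.val₂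
  have v₃ := ha.val₃
  have h0 : ∀ k, 0 ≤ a k := fun k => by
    rcases le_or_gt k 0 with h | h
    · exact (ha.zero_of_nonpos k h).ge
    rcases le_or_gt k m with h' | h'
    · exact (ha.logConcave.1 k h h').le
    rcases (show m + 1 ≤ k by omega).eq_or_lt with h' | h'
    · rw [show k = m + 1 by omega, v]; exact zero_le_one
    · exact (z k (by omega)).ge
  have hin : ∀ i j, 1 ≤ i → i ≤ j → j < m → 0 < crossDiff a i j := fun i j hi hij hj =>
    ha.logConcave.crossDiff_pos (ha.zero_of_nonpos 0 le_rfl) hi hij hj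
  have hlast : ∀ i, 1 ≤ i → i < m → 0 ≤ crossDiff a i m := by
    intro i hi him
    rw [crossDiff, v, mul_one, sub_nonneg, v₀]
    rcases (show i ≤ m - 1 by omega).eq_or_lt with rfl | hi'
    · rw [show m - 1 - 1 = m - 2 by ring, v₁]
      linarith
    -- Monotonicity of ratios bounds `a (i - 1) / a i` by `a (m - 2) / a (m - 1)`, which `val₂`
    -- bounds by `h - 1`.
    · have hx := hin i (m - 2) hi (by omega) (by omega)
      rw [crossDiff, show m - 2 + 1 = m - 1 by ring, v₁, sub_pos] at hx
      have hy : a i * a (m - 2) ≤ a i * (h * (h - 1) ^ 2) := mul_le_mul_of_nonneg_left v₂ (h0 i)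
      have hz : 0 < h * (h - 1) := mul_pos (by omega) (by omega)
      refine le_of_mul_le_mul_right ?_ hz
      linarith
  have hc : ∀ i j, i ≤ j → ¬(i = m ∧ j = m) → 0 ≤ crossDiff a i j := by
    intro i j hij hne
    rcases le_or_gt i 0 with h | h
    · rw [crossDiff, ha.zero_of_nonpos i h, ha.zero_of_nonpos (i - 1) (by omega)]
      simp
    rcases lt_trichotomy j m with h' | rfl | h'
    · exact (hin i j h hij h').le
    · exact hlast i h (by omega)
    · rw [crossDiff, z (j + 1) (by omega), mul_zero, sub_zero]
      exact mul_nonneg (h0 _) (h0 _)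
  have e₁ := windowSum_eq_of_forall_gt z (show 1 ≤ s by omega)
  have e₂ := windowSum_eq_of_forall_gt z (show 2 ≤ s by omega)
  have e₃ := windowSum_eq_of_forall_gt z (show 3 ≤ s by omega)
  have e₄ := windowSum_eq_of_forall_gt z (show 4 ≤ s by omega)
  have e₀ := windowSum_eq_of_forall_gt z (show 0 ≤ s by omega)
  simp only [sum_range_succ, sum_range_zero, Nat.cast_zero, Nat.cast_one, Nat.cast_ofNat, sub_zero,
    zero_add, v, add_sub_cancel_right, v₀, show m + 1 - 2 = m - 1 by ring,
    show m + 1 - 3 = m - 2 by ring, show m + 1 - 4 = m - 3 by ring, v₁]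
    at e₀ e₁ e₂ e₃ e₄
  have f₀ : b (m + s) = h := by
    rw [hb' _ le_rfl, show m + s = m + 1 + s - 1 by ring, e₁]; ring
  have f₁ : b (m + s - 1) = h ^ 2 := by
    rw [hb' _ (by omega), show m + s - 1 = m + 1 + s - 2 by ring, e₂]; ring
  have f₂ : b (m + s - 2) = h ^ 2 + a (m - 2) := by
    rw [hb' _ (by omega), show m + s - 2 = m + 1 + s - 3 by ring, e₃]; ring
  have f₃ : b (m + s - 3) = h ^ 2 + a (m - 2) + a (m - 3) := by
    rw [hb' _ (by omega), show m + s - 3 = m + 1 + s - 4 by ring, e₄]; ring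
  refine ⟨fun k hk => ?_, fun k hk => ?_, ?_, ?_, ?_, ?_, ?_⟩
  · rw [hb' k (by omega), windowSum_eq_zero_of_nonpos ha.zero_of_nonpos hk]
  · rcases (show m + s + 1 ≤ k by omega).eq_or_lt with rfl | hk
    · rw [hb, show m + s + 1 = m + 1 + s by ring, e₀, if_pos rfl]; rfl
    · rw [hb, windowSum_eq_zero_of_gt z (by omega), if_neg (by omega), add_zero]
  · refine (windowSum_logConcaveUpTo (by omega) hsm h0 ha.logConcave.1
      (fun k h₁ h₂ => hin k k h₁ le_rfl h₂) hc ?_).congr hb'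
    -- The terms `j = 0, 1, 2` add up to the expression in `val₃`; the others are nonnegative.
    obtain ⟨t, rfl⟩ : ∃ t, s = t + 3 := ⟨s - 3, by omega⟩
    rw [sum_range_succ', sum_range_succ', sum_range_succ']
    have hr : 0 ≤ ∑ j ∈ range t, crossDiff a (m - ((j + 1 + 1 + 1 : ℕ) : ℤ)) m :=
      sum_nonneg fun j _ => hc _ _ (by omega) (by omega)
    simp only [crossDiff, v, v₀, v₁, Nat.cast_zero, Nat.cast_one, Nat.cast_add, zero_add, sub_zero,
      show m - 1 - 1 = m - 2 by ring, show m - (1 + 1) = m - 2 by ring,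
      show m - 2 - 1 = m - 3 by ring] at hr ⊢
    linear_combination hr + v₃
  · rw [f₀]; ring
  · rw [f₁]; ring
  · rw [f₂]
    nlinarith
  · rw [f₂, f₃]
    -- Bounding `a (m - 3)` by the old `val₃` and then `a (m - 2)` by `val₂` leaves `h^3 + h^2 - 4 *
    -- h - 1 > 0`.
    nlinarith [mul_nonneg (show 0 ≤ h by omega) (show 0 ≤ h - 3 by omega),
      mul_nonneg (sq_nonneg h) (show 0 ≤ h - 3 by omega)]

end LogConcavity

/-! ### Base case, induction and conclusion. -/

section Main
open Polynomial

lemma qDerangement_five : qDerangement 5 =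
    X + 3 * X ^ 2 + 5 * X ^ 3 + 7 * X ^ 4 + 8 * X ^ 5 + 8 * X ^ 6 + 6 * X ^ 7 + 4 * X ^ 8
      + 2 * X ^ 9 := by
  simp only [qDerangement_succ, qDerangement_zero, Finset.sum_range_succ, Finset.sum_range_zero,
    show Nat.choose 1 2 = 0 from rfl, show Nat.choose 2 2 = 1 from rfl,
    show Nat.choose 3 2 = 3 from rfl, show Nat.choose 4 2 = 6 from rfl,
    show Nat.choose 5 2 = 10 from rfl, Nat.zero_add, Nat.reduceAdd]
  ring

lemma coeff_qDerangement_five (k : ℕ) : (qDerangement 5).coeff k =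
    if k = 1 then 1 else if k = 2 then 3 else if k = 3 then 5 else if k = 4 then 7 else
    if k = 5 then 8 else if k = 6 then 8 else if k = 7 then 6 else if k = 8 then 4 else
    if k = 9 then 2 else 0 := by
  have e : ∀ c : ℤ, ∀ i : ℕ, (C c * X ^ i : Polynomial ℤ).coeff k = if k = i then c else 0 :=
    fun c i => by rw [coeff_C_mul_X_pow]
  have h : qDerangement 5 = C 1 * X ^ 1 + C 3 * X ^ 2 + C 5 * X ^ 3 + C 7 * X ^ 4 + C 8 * X ^ 5 +
      C 8 * X ^ 6 + C 6 * X ^ 7 + C 4 * X ^ 8 + C 2 * X ^ 9 := by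
    rw [qDerangement_five]
    simp
  rw [h]
  simp only [coeff_add, e]
  rcases lt_or_ge 9 k with hk | hk
  · repeat rw [if_neg (by omega)]
    rfl
  · interval_cases k <;> rfl

lemma derangementCoeff_five (k : ℤ) : derangementCoeff 5 k =
    if k = 1 then 1 else if k = 2 then 3 else if k = 3 then 5 else if k = 4 then 7 else
    if k = 5 then 8 else if k = 6 then 8 else if k = 7 then 6 else if k = 8 then 4 else
    if k = 9 then 2 else 0 := by
  rcases lt_or_ge k 0 with hk | hk
  · rw [derangementCoeff, if_neg (by omega)]
    split_ifs <;> omega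
  · obtain ⟨k, rfl⟩ := Int.eq_ofNat_of_zero_le hk
    rw [derangementCoeff_natCast, coeff_qDerangement_five]
    norm_cast

/-- The induction cannot start at `n = 4`: the coefficients `1, 2, 2, 2, 1, 1` are not strictly
log-concave. -/
lemma oddProfile_five : OddProfile (derangementCoeff 5) 3 9 := by
  refine ⟨fun k hk => ?_, fun k hk => ?_, ⟨fun k h₁ h₂ => ?_, fun k h₁ h₂ => ?_⟩, ?_, ?_, ?_, ?_⟩
  · rw [derangementCoeff_five]
    split_ifs <;> omega
  · rw [derangementCoeff_five]
    split_ifs <;> omega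
  · interval_cases k <;> norm_num [derangementCoeff_five]
  · interval_cases k <;> norm_num [derangementCoeff_five]
  all_goals norm_num [derangementCoeff_five]

lemma cast_choose_two (n : ℕ) : (((n + 1).choose 2 : ℕ) : ℤ) = n + (n.choose 2 : ℕ) := by
  rw [Nat.choose_succ_succ' n 1, Nat.choose_one_right]
  push_cast
  ring

/-- Supplies the condition `s ≤ m` of the profile steps, with `s = n`. -/
lemma le_choose_two_sub_one {n : ℕ} (hn : 5 ≤ n) : (n : ℤ) ≤ (n.choose 2 : ℕ) - 1 := by
  induction n, hn using Nat.le_induction with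
  | base => decide
  | succ n hn ih =>
    rw [cast_choose_two]
    push_cast
    omega

/-- The shapes of the coefficients of `d_{2h-1}(q)` and of `d_{2h}(q)`. -/
lemma derangementCoeff_profile {h : ℕ} (hh : 3 ≤ h) :
    OddProfile (derangementCoeff (2 * h - 1)) h (((2 * h - 1).choose 2 : ℕ) - 1) ∧
      EvenProfile (derangementCoeff (2 * h)) h (((2 * h).choose 2 : ℕ) - 1) := by
  have step : ∀ h : ℕ, 3 ≤ h →
      OddProfile (derangementCoeff (2 * h - 1)) h (((2 * h - 1).choose 2 : ℕ) - 1) →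
      EvenProfile (derangementCoeff (2 * h)) h (((2 * h).choose 2 : ℕ) - 1) := by
    intro h hh ho
    obtain ⟨s, hs⟩ : ∃ s, 2 * h - 1 = s := ⟨_, rfl⟩
    have hs' : 2 * h = s + 1 := by omega
    rw [hs] at ho
    have hev : Even (s + 1) := ⟨h, by omega⟩
    rw [hs', cast_choose_two, show (s : ℤ) + (s.choose 2 : ℕ) - 1 = (s.choose 2 : ℕ) - 1 + s by ring]
    refine ho.evenProfile (by omega) (le_choose_two_sub_one (by omega)) fun k => ?_
    rw [derangementCoeff_succ, windowSum, hev.neg_one_pow, cast_choose_two,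
      show ((s.choose 2 : ℕ) : ℤ) - 1 + s + 1 = s + (s.choose 2 : ℕ) by ring]
  induction h, hh using Nat.le_induction with
  | base =>
    have h5 : OddProfile (derangementCoeff (2 * 3 - 1)) (3 : ℕ) (((2 * 3 - 1).choose 2 : ℕ) - 1) :=
      oddProfile_five
    exact ⟨h5, step 3 le_rfl h5⟩
  | succ h hh ih =>
    have ho : OddProfile (derangementCoeff (2 * (h + 1) - 1)) (h + 1 : ℕ)
        (((2 * (h + 1) - 1).choose 2 : ℕ) - 1) := by
      have he := ih.2
      obtain ⟨s, hs⟩ : ∃ s, 2 * h = s := ⟨_, rfl⟩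
      rw [hs] at he
      have hod : Odd (s + 1) := ⟨h, by omega⟩
      rw [show 2 * (h + 1) - 1 = s + 1 by omega, cast_choose_two, Nat.cast_succ,
        show (s : ℤ) + (s.choose 2 : ℕ) - 1 = (s.choose 2 : ℕ) - 1 + s by ring]
      refine he.oddProfile (by omega) (by omega) (le_choose_two_sub_one (by omega)) fun k => ?_
      rw [derangementCoeff_succ, windowSum, hod.neg_one_pow, cast_choose_two,
        show ((s.choose 2 : ℕ) : ℤ) - 1 + s + 1 = s + (s.choose 2 : ℕ) by ring]
    exact ⟨ho, step (h + 1) (by omega) ho⟩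

lemma qDerangementCoeff_eq (n k : ℕ) : qDerangementCoeff n k = (derangementCoeff n k : ℤ) := by
  rw [qDerangementCoeff, derangementCoeff_natCast]

lemma LogConcaveUpTo.isStrictLogConcaveSeq {n m : ℕ}
    (h : LogConcaveUpTo (derangementCoeff n) m) :
    IsStrictLogConcaveSeq (qDerangementCoeff n) m := by
  have hp : ∀ k, 1 ≤ k → k ≤ m → 0 < qDerangementCoeff n k := fun k h₁ h₂ => by
    rw [qDerangementCoeff_eq]
    exact_mod_cast h.1 k (by omega) (by omega)
  refine ⟨hp, fun k h₁ h₂ => ?_⟩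
  rw [div_lt_div_iff₀ (hp _ (by omega) (by omega)) (hp _ (by omega) h₂), qDerangementCoeff_eq,
    qDerangementCoeff_eq, qDerangementCoeff_eq, ← sq]
  have := h.2 (k + 1) (by omega) (by omega)
  rw [add_sub_cancel_right, add_assoc, one_add_one_eq_two] at this
  exact_mod_cast this

lemma natDegree_qDerangement_eq {n d : ℕ} (h₁ : ∀ k : ℤ, d < k → derangementCoeff n k = 0)
    (h₂ : derangementCoeff n d ≠ 0) : (qDerangement n).natDegree = d := by
  refine natDegree_eq_of_le_of_coeff_ne_zero ?_ (by rwa [← derangementCoeff_natCast])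
  rw [natDegree_le_iff_coeff_eq_zero]
  intro k hk
  rw [← derangementCoeff_natCast]
  exact h₁ k (by exact_mod_cast hk)

end Main

theorem mainTheorem2 (n r β : ℕ) (hn : 6 ≤ n) (hr : r = n * (n - 1) / 2 - 1)
    (hβ : β = (qDerangement n).natDegree) :
    -- the chain `A_n(1)/A_n(2) < A_n(2)/A_n(3) < ⋯ < A_n(r-1)/A_n(r)`
    (∀ k, 1 ≤ k → k + 2 ≤ r →
      qDerangementCoeff n k / qDerangementCoeff n (k + 1) <
        qDerangementCoeff n (k + 1) / qDerangementCoeff n (k + 2)) ∧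
    -- there is no constant term
    qDerangementCoeff n 0 = 0 ∧
    -- for odd `n` all the coefficients `A_n(1), …, A_n(β)` are log-concave
    (Odd n → β = r ∧ IsStrictLogConcaveSeq (qDerangementCoeff n) β) ∧
    -- for even `n` all but the last one are, and the last one violates log-concavity
    (Even n → β = r + 1 ∧ IsStrictLogConcaveSeq (qDerangementCoeff n) (β - 1) ∧
      0 < qDerangementCoeff n β ∧
      qDerangementCoeff n (β - 1) / qDerangementCoeff n (β - 2) <
        qDerangementCoeff n β / qDerangementCoeff n (β - 1)) := by
  rw [← Nat.choose_two_right] at hr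
  have hm : (r : ℤ) = (n.choose 2 : ℕ) - 1 := by
    have := le_choose_two_sub_one (show 5 ≤ n by omega)
    omega
  have hrn : (n : ℤ) ≤ r := hm ▸ le_choose_two_sub_one (show 5 ≤ n by omega)
  obtain ⟨h, rfl | rfl⟩ : ∃ h, n = 2 * h ∨ n = 2 * h - 1 := ⟨(n + 1) / 2, by omega⟩
  · have hp := (derangementCoeff_profile (show 3 ≤ h by omega)).2
    rw [← hm] at hp
    have hβ' : β = r + 1 := by
      rw [hβ]
      refine natDegree_qDerangement_eq (fun k hk => hp.zero_of_gt k (by exact_mod_cast hk)) ?_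
      rw [Nat.cast_succ, hp.last]
      exact one_ne_zero
    have hlc := hp.logConcave.isStrictLogConcaveSeq
    have h₁ : qDerangementCoeff (2 * h) (r + 1) = 1 := by
      rw [qDerangementCoeff_eq, Nat.cast_succ, hp.last, Int.cast_one]
    have h₂ : qDerangementCoeff (2 * h) r = h - 1 := by
      rw [qDerangementCoeff_eq, hp.val₀]
      push_cast
      rfl
    have h₃ : qDerangementCoeff (2 * h) (r - 1) = h * (h - 1) := by
      rw [qDerangementCoeff_eq, Nat.cast_sub (by omega), Nat.cast_one, hp.val₁]
      push_cast
      rfl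
    have hh : (3 : ℚ) ≤ h := by exact_mod_cast (show 3 ≤ h by omega)
    refine ⟨hlc.2, ?_, fun hodd => ?_, fun _ => ⟨hβ', ?_, ?_, ?_⟩⟩
    · rw [qDerangementCoeff_eq, Nat.cast_zero, hp.zero_of_nonpos 0 le_rfl, Int.cast_zero]
    · exact absurd hodd (by simp)
    · rw [hβ']
      exact hlc
    · rw [hβ', h₁]
      exact one_pos
    -- The top coefficients are `h * (h - 1)`, `h - 1`, `1`, with ratios `1 / h < 1 / (h - 1)`.
    · rw [hβ', Nat.add_sub_cancel, show r + 1 - 2 = r - 1 by omega, h₁, h₂, h₃,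
        div_lt_div_iff₀ (by nlinarith) (by linarith)]
      nlinarith
  · have hp := (derangementCoeff_profile (show 3 ≤ h by omega)).1
    rw [← hm] at hp
    have hβ' : β = r := by
      rw [hβ]
      refine natDegree_qDerangement_eq hp.zero_of_gt (hp.logConcave.1 r (by omega) le_rfl).ne'
    have hlc := hp.logConcave.isStrictLogConcaveSeq
    refine ⟨hlc.2, ?_, fun _ => ⟨hβ', hβ' ▸ hlc⟩, fun heven => ?_⟩
    · rw [qDerangementCoeff_eq, Nat.cast_zero, hp.zero_of_nonpos 0 le_rfl, Int.cast_zero]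
    · obtain ⟨j, hj⟩ := heven
      omega
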